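/- Let $[n]=\{0,\dots,n-1\}$ be a set of players. A strategy of player $u$ is a set $\sigma_u\subseteq [n]\setminus\{u\}$ (the players to whom $u$ opens a channel), and a strategy combination $\sigma=(\sigma_u)_{u\in[n]}$ induces the undirected graph $G[\sigma]$ on $[n]$ in which $u\neq v$ are adjacent iff $v\in\sigma_u$ or $u\in\sigma_v$. For weights $b\ge 0$ and $c>0$ the cost of player $u$ is $$\mathrm{cost}_u(\sigma)=|\sigma_u|+b\Bigl((n-1)(n-2)-\sum_{\substack{x,y\in[n]\setminus\{u\}\\ x\ne y,\ m(x,y)>0}}\frac{m_u(x,y)}{m(x,y)}\Bigr)+c\sum_{v\in[n]\setminus\{u\}}\bigl(d_{G[\sigma]}(u,v)-1\bigr),$$ where the first sum runs over ordered pairs, $m(x,y)$ is the number of shortest paths from $x$ to $y$ in $G[\sigma]$, $m_u(x,y)$ is the number of those passing through $u$, and $d_{G[\sigma]}$ is the graph distance (so the cost is $+\infty$ if $G[\sigma]$ is disconnected). The combination $\sigma$ is a Nash equilibrium if no player can decrease her cost by changing only her own strategy. **Theorem.** Let $3\le r\le s$, $b\ge 0$ and $c>0$, and let $\sigma$ be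 a strategy combination such that $G[\sigma]$ is the complete bipartite graph $K_{r,s}$ and all links are established by the players of the subset of size $r$ (the players of the subset of size $s$ open no channels). Then $\sigma$ is a Nash equilibrium if and only if $$\frac{s-2}{r+1}\,b+c\ \le\ 1\ \le\ \min\Bigl\{\frac{s}{r}\,b+\frac{s+r-3}{s-1}\,c,\ \min\{\alpha,\beta\}\cdot b+c\Bigr\},$$ where $$\alpha=\frac{s(s-1)}{r(s-2)},\qquad \beta=\frac{1}{s-r+1}\left(\frac{s(s-1)}{r}-\frac{(r-2)(r-1)}{s+1}\right).$$ -/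

import Mathlib

namespace PaymentNetwork

noncomputable section

/-- A strategy combination: each player `u ∈ [n]` picks a set of players other than `u`,
to each of whom she opens a channel. -/
abbrev Profile (n : ℕ) : Type := (u : Fin n) → {t : Finset (Fin n) // u ∉ t}

/-- The undirected graph `G[σ]` underlying the digraph with an arc from `u` to `v`
whenever `v ∈ σ u`. -/
def graph {n : ℕ} (σ : Profile n) : SimpleGraph (Fin n) :=
  SimpleGraph.fromRel fun u v => v ∈ (σ u).1

/-- `m(x, y)`: the number of shortest paths from `x` to `y`
(it is `0` if `y` cannot be reached from `x`). -/
def numShortest {n : ℕ} (G : SimpleGraph (Fin n)) (x y : Fin n) : ℕ :=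
  Set.ncard {p : G.Walk x y | p.IsPath ∧ p.length = G.dist x y}

/-- `m_u(x, y)`: the number of shortest paths from `x` to `y` that pass through `u`. -/
def numShortestThrough {n : ℕ} (G : SimpleGraph (Fin n)) (u x y : Fin n) : ℕ :=
  Set.ncard {p : G.Walk x y | p.IsPath ∧ p.length = G.dist x y ∧ u ∈ p.support}

/-- The betweenness cost of `u`: the maximal value `(n-1)(n-2)` minus Freeman's betweenness
centrality, a sum over ordered pairs `(x, y)` of distinct players other than `u`. -/
def betweenness {n : ℕ} (σ : Profile n) (u : Fin n) : ℝ :=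
  ((n : ℝ) - 1) * ((n : ℝ) - 2) -
    ∑ q : Fin n × Fin n with
        q.1 ≠ q.2 ∧ q.1 ≠ u ∧ q.2 ≠ u ∧ 0 < numShortest (graph σ) q.1 q.2,
      (numShortestThrough (graph σ) u q.1 q.2 : ℝ) / (numShortest (graph σ) q.1 q.2 : ℝ)

/-- The closeness cost of `u`: the sum of `d(u, v) - 1` over all players `v ≠ u`. It is infinite
if the graph is disconnected. The subtraction does not truncate, since `d(u, v) ≥ 1`. -/
def closeness {n : ℕ} (σ : Profile n) (u : Fin n) : ℕ∞ :=
  ∑ v : Fin n with v ≠ u, ((graph σ).edist u v - 1)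

/-- The cost of player `u`, with betweenness weight `b` and closeness weight `c`; the price of a
channel is `1`. -/
def cost {n : ℕ} (b c : ℝ) (σ : Profile n) (u : Fin n) : EReal :=
  (((σ u).1.card : ℝ) : EReal) + ((b * betweenness σ u : ℝ) : EReal) +
    (c : EReal) * (((closeness σ u : ℕ∞) : ENNReal) : EReal)

/-- No player can lower her cost by changing only her own strategy. -/
def IsNashEquilibrium {n : ℕ} (b c : ℝ) (σ : Profile n) : Prop :=
  ∀ (u : Fin n) (t : {t : Finset (Fin n) // u ∉ t}),
    cost b c σ u ≤ cost b c (Function.update σ u t) u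

/-- `α = s(s-1) / (r(s-2))`. -/
def bicliqueAlpha (r s : ℕ) : ℝ :=
  ((s : ℝ) * ((s : ℝ) - 1)) / ((r : ℝ) * ((s : ℝ) - 2))

/-- `β = (s(s-1)/r - (r-2)(r-1)/(s+1)) / (s-r+1)`. -/
def bicliqueBeta (r s : ℕ) : ℝ :=
  1 / ((s : ℝ) - (r : ℝ) + 1) *
    (((s : ℝ) * ((s : ℝ) - 1)) / (r : ℝ) -
      (((r : ℝ) - 2) * ((r : ℝ) - 1)) / ((s : ℝ) + 1))

end

end PaymentNetwork

namespace PaymentNetwork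

/-! ### Shortest paths of length at most three -/

section ShortestPaths

variable {n : ℕ} {G : SimpleGraph (Fin n)} {u x y z w : Fin n}

/-! Deleting a player `u` leaves a complete bipartite graph whatever `u` does, so after any
deviation her cost depends only on her numbers of channels and of neighbours in each part. Only
same-part pairs can route through `u`, and her distances are at most 3 once she has a neighbour.
This gives the closed form `bicliqueCost` (`cost_eq_bicliqueCost`); isolation costs infinity.

Players on the silent side keep their links to the other side and can only add some inside their
own. By `forall_bicliqueCost_le_right_iff` the best such deviation links to all of it or to nobody,
which yields the upper bound `≤ 1`.

A linking player chooses `a` neighbours across and `l` on her own side. On each region `a = 0`, `l =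
0`, `a, l ≥ 1` the cost change is concave in each variable separately, so it is nonnegative once it
is so at the corners. In `forall_bicliqueCost_le_left_iff` the corners `(0, 1)`, `(1, 1)` and `(0, r
- 1)` give exactly the three lower bounds; the other corners follow from these, from the upper bound
and from `r ≤ s`. -/

lemma edist_eq_two (hxy : x ≠ y) (hn : ¬ G.Adj x y) (hxz : G.Adj x z) (hzy : G.Adj z y) :
    G.edist x y = 2 := by
  refine le_antisymm (by simpa using SimpleGraph.edist_le (hxz.toWalk.append hzy.toWalk)) ?_
  obtain ⟨p, hp⟩ :=
    (hxz.reachable.trans hzy.reachable).exists_walk_length_eq_edist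
  rw [← hp]
  match p with
  | .nil => exact absurd rfl hxy
  | .cons h .nil => exact absurd h hn
  | .cons h (.cons h' p') =>
    simp only [SimpleGraph.Walk.length_cons]
    exact_mod_cast (by omega : 2 ≤ p'.length + 1 + 1)

lemma edist_eq_three (hxy : x ≠ y) (hn : ¬ G.Adj x y) (hcn : ∀ v, G.Adj x v → ¬ G.Adj v y)
    (hxz : G.Adj x z) (hzw : G.Adj z w) (hwy : G.Adj w y) : G.edist x y = 3 := by
  refine le_antisymm (by
    simpa using SimpleGraph.edist_le (.cons hxz (.cons hzw (.cons hwy .nil)))) ?_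
  obtain ⟨p, hp⟩ :=
    ((hxz.reachable.trans hzw.reachable).trans hwy.reachable).exists_walk_length_eq_edist
  rw [← hp]
  match p with
  | .nil => exact absurd rfl hxy
  | .cons h .nil => exact absurd h hn
  | .cons h (.cons h' .nil) => exact absurd h' (hcn _ h)
  | .cons h (.cons h' (.cons h'' p')) =>
    simp only [SimpleGraph.Walk.length_cons]
    exact_mod_cast (by omega : 3 ≤ p'.length + 1 + 1 + 1)

lemma edist_sub_one_of_adj (h : G.Adj x y) : G.edist x y - 1 = 0 := by
  rw [SimpleGraph.edist_eq_one_iff_adj.2 h, tsub_self]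

lemma dist_eq_two (hxy : x ≠ y) (hn : ¬ G.Adj x y) (hxz : G.Adj x z) (hzy : G.Adj z y) :
    G.dist x y = 2 := by
  rw [SimpleGraph.dist, edist_eq_two hxy hn hxz hzy]; rfl

lemma numShortestThrough_eq_zero_of_adj (h : G.Adj x y) (hx : u ≠ x) (hy : u ≠ y) :
    numShortestThrough G u x y = 0 := by
  rw [numShortestThrough, SimpleGraph.dist_eq_one_iff_adj.2 h]
  convert Set.ncard_empty (G.Walk x y)
  rw [Set.eq_empty_iff_forall_notMem]
  rintro p ⟨-, hl, hu⟩
  match p with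
  | .nil => simp at hl
  | .cons h .nil => simp [hx, hy] at hu
  | .cons h (.cons h' p') => simp at hl

lemma isPath_cons_cons_nil (hxy : x ≠ y) (hxz : G.Adj x z) (hzy : G.Adj z y) :
    (SimpleGraph.Walk.cons hxz (.cons hzy .nil)).IsPath := by
  simp [hxz.ne, hzy.ne, hxy]

lemma numShortest_eq_ncard_commonNeighbors (hxy : x ≠ y) (hn : ¬ G.Adj x y)
    (hxz : G.Adj x z) (hzy : G.Adj z y) :
    numShortest G x y = (G.commonNeighbors x y).ncard := by
  rw [numShortest, dist_eq_two hxy hn hxz hzy]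
  refine Set.ncard_congr (fun p _ => p.snd) ?_ ?_ ?_
  · rintro p ⟨-, hl⟩
    match p with
    | .cons h (.cons h' .nil) => simpa [SimpleGraph.mem_commonNeighbors] using ⟨h, h'.symm⟩
  · rintro p q ⟨-, hp⟩ ⟨-, hq⟩ hpq
    match p, q with
    | .cons h (.cons h' .nil), .cons k (.cons k' .nil) =>
      simp only [SimpleGraph.Walk.snd_cons] at hpq
      subst hpq
      rfl
  · rintro v hv
    rw [SimpleGraph.mem_commonNeighbors] at hv
    exact ⟨.cons hv.1 (.cons hv.2.symm .nil), ⟨isPath_cons_cons_nil hxy _ _, rfl⟩, by simp⟩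

lemma numShortestThrough_eq_one (hxy : x ≠ y) (hn : ¬ G.Adj x y)
    (hxu : G.Adj x u) (huy : G.Adj u y) : numShortestThrough G u x y = 1 := by
  rw [numShortestThrough, dist_eq_two hxy hn hxu huy, Set.ncard_eq_one]
  refine ⟨.cons hxu (.cons huy .nil), Set.eq_singleton_iff_unique_mem.2
    ⟨⟨isPath_cons_cons_nil hxy _ _, rfl, by simp⟩, ?_⟩⟩
  rintro p ⟨-, hl, hu⟩
  match p with
  | .cons h (.cons h' .nil) =>
    simp only [SimpleGraph.Walk.support_cons, SimpleGraph.Walk.support_nil, List.mem_cons,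
      List.not_mem_nil, or_false] at hu
    rcases hu with rfl | rfl | rfl
    · exact absurd rfl hxu.ne
    · rfl
    · exact absurd rfl huy.ne

lemma numShortestThrough_eq_zero (hxy : x ≠ y) (hn : ¬ G.Adj x y)
    (hxz : G.Adj x z) (hzy : G.Adj z y) (hx : u ≠ x) (hy : u ≠ y)
    (hu : ¬ (G.Adj x u ∧ G.Adj u y)) : numShortestThrough G u x y = 0 := by
  rw [numShortestThrough, dist_eq_two hxy hn hxz hzy]
  convert Set.ncard_empty (G.Walk x y)
  rw [Set.eq_empty_iff_forall_notMem]
  rintro p ⟨-, hl, hup⟩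
  match p with
  | .cons h (.cons h' .nil) =>
    simp only [SimpleGraph.Walk.support_cons, SimpleGraph.Walk.support_nil, List.mem_cons,
      List.not_mem_nil, or_false, hx, hy, false_or] at hup
    subst hup
    exact hu ⟨h, h'⟩

end ShortestPaths

/-! ### Betweenness and distances of a player attached to a biclique -/

/-- Deleting `u` from `G` leaves the complete bipartite graph with nonempty parts `X` and `Y`. -/
structure IsBicliqueAround {n : ℕ} (G : SimpleGraph (Fin n)) (u : Fin n) (X Y : Finset (Fin n)) :
    Prop where
  notMem_left : u ∉ X
  notMem_right : u ∉ Y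
  disjoint : Disjoint X Y
  cover : ∀ v, v ≠ u → v ∈ X ∨ v ∈ Y
  nonempty_left : X.Nonempty
  nonempty_right : Y.Nonempty
  adj : ∀ x ∈ X, ∀ y ∈ Y, G.Adj x y
  indep_left : ∀ x ∈ X, ∀ y ∈ X, ¬ G.Adj x y
  indep_right : ∀ x ∈ Y, ∀ y ∈ Y, ¬ G.Adj x y

namespace IsBicliqueAround

variable {n : ℕ} {G : SimpleGraph (Fin n)} {u : Fin n} {X Y A B : Finset (Fin n)}

lemma symm (h : IsBicliqueAround G u X Y) : IsBicliqueAround G u Y X where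
  notMem_left := h.notMem_right
  notMem_right := h.notMem_left
  disjoint := h.disjoint.symm
  cover v hv := (h.cover v hv).symm
  nonempty_left := h.nonempty_right
  nonempty_right := h.nonempty_left
  adj x hx y hy := (h.adj y hy x hx).symm
  indep_left := h.indep_right
  indep_right := h.indep_left

lemma ne_of_mem_left (h : IsBicliqueAround G u X Y) {x : Fin n} (hx : x ∈ X) : u ≠ x :=
  fun e => h.notMem_left (e ▸ hx)

lemma numShortest_pos (h : IsBicliqueAround G u X Y) {x y : Fin n} (hx : x ∈ X) (hy : y ∈ X)
    (hxy : x ≠ y) : 0 < numShortest G x y := by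
  obtain ⟨z, hz⟩ := h.nonempty_right
  rw [numShortest_eq_ncard_commonNeighbors hxy (h.indep_left x hx y hy) (h.adj x hx z hz)
    (h.adj y hy z hz).symm, Set.ncard_pos (Set.toFinite _)]
  exact ⟨z, h.adj x hx z hz, h.adj y hy z hz⟩

/-- The common neighbours of `x` and `y` are all of `Y`, together with `u` if she is adjacent to
both; each carries one shortest path. -/
lemma numShortestThrough_div (h : IsBicliqueAround G u X Y) {x y : Fin n} (hx : x ∈ X)
    (hy : y ∈ X) (hxy : x ≠ y) (hA : ∀ v, v ∈ A ↔ v ∈ X ∧ G.Adj u v) :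
    (numShortestThrough G u x y : ℝ) / numShortest G x y =
      if x ∈ A ∧ y ∈ A then 1 / ((Y.card : ℝ) + 1) else 0 := by
  obtain ⟨z, hz⟩ := h.nonempty_right
  have hn := h.indep_left x hx y hy
  have hxz := h.adj x hx z hz
  have hzy := (h.adj y hy z hz).symm
  split_ifs with hc
  · have hux := ((hA x).1 hc.1).2
    have huy := ((hA y).1 hc.2).2
    rw [numShortestThrough_eq_one hxy hn hux.symm huy,
      numShortest_eq_ncard_commonNeighbors hxy hn hxz hzy]
    have : G.commonNeighbors x y = (insert u Y : Finset (Fin n)) := by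
      ext v
      rw [SimpleGraph.mem_commonNeighbors, Finset.mem_coe, Finset.mem_insert]
      constructor
      · rintro ⟨h1, -⟩
        by_contra! hv
        exact (h.cover v hv.1).elim (fun hv' => h.indep_left x hx v hv' h1) hv.2
      · rintro (rfl | hv)
        · exact ⟨hux.symm, huy.symm⟩
        · exact ⟨h.adj x hx v hv, h.adj y hy v hv⟩
    rw [this, Set.ncard_coe_finset, Finset.card_insert_of_notMem h.notMem_right]
    push_cast
    rfl
  · rw [numShortestThrough_eq_zero hxy hn hxz hzy (h.ne_of_mem_left hx) (h.ne_of_mem_left hy)]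
    · simp
    · rintro ⟨h1, h2⟩
      exact hc ⟨(hA x).2 ⟨hx, h1.symm⟩, (hA y).2 ⟨hy, h2⟩⟩

/-- Pairs from different parts are adjacent and bypass `u`. Within a part, exactly the ordered pairs
of distinct neighbours of `u` contribute, all equally. -/
lemma sum_numShortestThrough_div (h : IsBicliqueAround G u X Y)
    (hA : ∀ v, v ∈ A ↔ v ∈ X ∧ G.Adj u v) (hB : ∀ v, v ∈ B ↔ v ∈ Y ∧ G.Adj u v) :
    ∑ q : Fin n × Fin n with
        q.1 ≠ q.2 ∧ q.1 ≠ u ∧ q.2 ≠ u ∧ 0 < numShortest G q.1 q.2,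
      (numShortestThrough G u q.1 q.2 : ℝ) / (numShortest G q.1 q.2 : ℝ) =
    (A.card : ℝ) * (A.card - 1) / (Y.card + 1) + (B.card : ℝ) * (B.card - 1) / (X.card + 1) := by
  have key : ∀ q : Fin n × Fin n,
      (if q.1 ≠ q.2 ∧ q.1 ≠ u ∧ q.2 ≠ u ∧ 0 < numShortest G q.1 q.2 then
        (numShortestThrough G u q.1 q.2 : ℝ) / (numShortest G q.1 q.2 : ℝ) else 0) =
      (if q ∈ A.offDiag then 1 / ((Y.card : ℝ) + 1) else 0) +
        (if q ∈ B.offDiag then 1 / ((X.card : ℝ) + 1) else 0) := by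
    rintro ⟨x, y⟩
    simp only [Finset.mem_offDiag]
    have hAX : ∀ v, v ∈ A → v ∈ X := fun v hv => ((hA v).1 hv).1
    have hBY : ∀ v, v ∈ B → v ∈ Y := fun v hv => ((hB v).1 hv).1
    have hXY : ∀ v, v ∈ X → v ∉ Y := fun _ hv => Finset.disjoint_left.1 h.disjoint hv
    have huA : u ∉ A := fun hu => h.notMem_left (hAX u hu)
    have huB : u ∉ B := fun hu => h.notMem_right (hBY u hu)
    by_cases hxy : x = y
    · simp [hxy]
    by_cases hxu : x = u
    · simp [hxu, huA, huB]
    by_cases hyu : y = u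
    · simp [hyu, huA, huB]
    rcases h.cover x hxu with hx | hx <;> rcases h.cover y hyu with hy | hy
    · have hxB : x ∉ B := fun hb => hXY x hx (hBY x hb)
      rw [if_pos ⟨hxy, hxu, hyu, h.numShortest_pos hx hy hxy⟩,
        h.numShortestThrough_div hx hy hxy hA]
      simp [hxB, hxy]
    · have hxB : x ∉ B := fun hb => hXY x hx (hBY x hb)
      have hyA : y ∉ A := fun ha => hXY y (hAX y ha) hy
      simp [hxB, hyA, numShortestThrough_eq_zero_of_adj (h.adj x hx y hy) (Ne.symm hxu)
        (Ne.symm hyu)]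
    · have hyB : y ∉ B := fun hb => hXY y hy (hBY y hb)
      have hxA : x ∉ A := fun ha => hXY x (hAX x ha) hx
      simp [hyB, hxA, numShortestThrough_eq_zero_of_adj (h.adj y hy x hx).symm (Ne.symm hxu)
        (Ne.symm hyu)]
    · have hxA : x ∉ A := fun ha => hXY x (hAX x ha) hx
      rw [if_pos ⟨hxy, hxu, hyu, h.symm.numShortest_pos hx hy hxy⟩,
        h.symm.numShortestThrough_div hx hy hxy hB]
      simp [hxA, hxy]
  have card_offDiag : ∀ C : Finset (Fin n),
      (C.offDiag.card : ℝ) = (C.card : ℝ) * (C.card - 1) := by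
    intro C
    rw [Finset.offDiag_card, Nat.cast_sub (Nat.le_mul_self _)]
    push_cast
    ring
  rw [Finset.sum_filter, Finset.sum_congr rfl fun q _ => key q, Finset.sum_add_distrib]
  simp only [Finset.sum_ite_mem, Finset.univ_inter, Finset.sum_const, nsmul_eq_mul, card_offDiag]
  ring

/-- A neighbour of `u` in `Y` reaches `v` in one more step. Without one, all neighbours of `u` lie
in the independent set `X`, and the detour through `Y` gives distance 3. -/
lemma edist_sub_one_left (h : IsBicliqueAround G u X Y)
    (hA : ∀ v, v ∈ A ↔ v ∈ X ∧ G.Adj u v) (hB : ∀ v, v ∈ B ↔ v ∈ Y ∧ G.Adj u v)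
    (hAB : A.Nonempty ∨ B.Nonempty) {v : Fin n} (hv : v ∈ X) (hvA : v ∉ A) :
    G.edist u v - 1 = ((if B.card = 0 then 2 else 1 : ℕ) : ℕ∞) := by
  have hn : ¬ G.Adj u v := fun hadj => hvA ((hA v).2 ⟨hv, hadj⟩)
  have huv := h.ne_of_mem_left hv
  rcases B.eq_empty_or_nonempty with hB0 | ⟨z, hz⟩
  · obtain ⟨z, hz⟩ := hAB.resolve_right (by simp [hB0])
    obtain ⟨w, hw⟩ := h.nonempty_right
    obtain ⟨hzX, huz⟩ := (hA z).1 hz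
    rw [edist_eq_three huv hn ?_ huz (h.adj z hzX w hw) (h.adj v hv w hw).symm]
    · simp only [hB0, Finset.card_empty, if_true]; rfl
    · intro a ha hav
      rcases h.cover a ha.ne' with haX | haY
      · exact h.indep_left a haX v hv hav
      · simpa [hB0] using (hB a).2 ⟨haY, ha⟩
  · obtain ⟨hzY, huz⟩ := (hB z).1 hz
    rw [edist_eq_two huv hn huz (h.adj v hv z hzY).symm,
      if_neg (Finset.card_pos.2 ⟨z, hz⟩).ne']
    rfl

lemma sum_edist_sub_one_left (h : IsBicliqueAround G u X Y)
    (hA : ∀ v, v ∈ A ↔ v ∈ X ∧ G.Adj u v) (hB : ∀ v, v ∈ B ↔ v ∈ Y ∧ G.Adj u v)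
    (hAB : A.Nonempty ∨ B.Nonempty) :
    ∑ v ∈ X, (G.edist u v - 1) =
      (((X.card - A.card) * (if B.card = 0 then 2 else 1) : ℕ) : ℕ∞) := by
  have hAX : A ⊆ X := fun v hv => ((hA v).1 hv).1
  rw [← Finset.sum_sdiff hAX, Finset.sum_eq_zero (s := A)
    fun v hv => edist_sub_one_of_adj ((hA v).1 hv).2, add_zero,
    Finset.sum_congr rfl fun v hv => h.edist_sub_one_left hA hB hAB
      (Finset.mem_sdiff.1 hv).1 (Finset.mem_sdiff.1 hv).2,
    Finset.sum_const, Finset.card_sdiff_of_subset hAX, nsmul_eq_mul, Nat.cast_mul]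

lemma filter_ne_eq_union (h : IsBicliqueAround G u X Y) :
    (Finset.univ.filter fun v => v ≠ u) = X ∪ Y := by
  ext v
  simp only [Finset.mem_filter, Finset.mem_univ, true_and, Finset.mem_union]
  refine ⟨h.cover v, ?_⟩
  rintro (hv | hv)
  · exact (h.ne_of_mem_left hv).symm
  · exact (h.symm.ne_of_mem_left hv).symm

lemma sum_edist_sub_one (h : IsBicliqueAround G u X Y)
    (hA : ∀ v, v ∈ A ↔ v ∈ X ∧ G.Adj u v) (hB : ∀ v, v ∈ B ↔ v ∈ Y ∧ G.Adj u v)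
    (hAB : A.Nonempty ∨ B.Nonempty) :
    ∑ v : Fin n with v ≠ u, (G.edist u v - 1) =
      (((X.card - A.card) * (if B.card = 0 then 2 else 1) +
        (Y.card - B.card) * (if A.card = 0 then 2 else 1) : ℕ) : ℕ∞) := by
  rw [h.filter_ne_eq_union, Finset.sum_union h.disjoint, h.sum_edist_sub_one_left hA hB hAB,
    h.symm.sum_edist_sub_one_left hB hA hAB.symm, ← Nat.cast_add]

lemma sum_edist_sub_one_eq_top (h : IsBicliqueAround G u X Y) (hN : ∀ v, ¬ G.Adj u v) :
    ∑ v : Fin n with v ≠ u, (G.edist u v - 1) = ⊤ := by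
  obtain ⟨x, hx⟩ := h.nonempty_left
  have hux := h.ne_of_mem_left hx
  rw [ENat.sum_eq_top]
  refine ⟨x, by simp [hux.symm], ?_⟩
  have : ¬ G.Reachable u x := by
    rintro ⟨p⟩
    match p with
    | .nil => exact hux rfl
    | .cons h _ => exact hN _ h
  rw [SimpleGraph.edist_eq_top_of_not_reachable this]
  rfl

end IsBicliqueAround

/-! ### Closed form of the cost -/

/-- The cost of a player with `k` channels of her own, in a network on `n` players that becomes the
complete bipartite graph with parts of sizes `p` and `q` when she is deleted, if she has `a`
neighbours in the first part and `l` in the second. -/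
noncomputable def bicliqueCost (b c : ℝ) (n p q k a l : ℕ) : ℝ :=
  k + b * (((n : ℝ) - 1) * ((n : ℝ) - 2) -
      ((a : ℝ) * (a - 1) / (q + 1) + (l : ℝ) * (l - 1) / (p + 1))) +
    c * (((p : ℝ) - a) * (if l = 0 then 2 else 1) + ((q : ℝ) - l) * (if a = 0 then 2 else 1))

lemma coe_ennreal_natCast (N : ℕ) : ((N : ENNReal) : EReal) = ((N : ℝ) : EReal) := by
  rw [← ENNReal.coe_natCast, EReal.coe_nnreal_eq_coe_real, NNReal.coe_natCast]

section Cost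

variable {n : ℕ} {b c : ℝ} {σ : Profile n} {u : Fin n} {X Y A B : Finset (Fin n)}

lemma cost_eq_bicliqueCost (h : IsBicliqueAround (graph σ) u X Y)
    (hA : ∀ v, v ∈ A ↔ v ∈ X ∧ (graph σ).Adj u v) (hB : ∀ v, v ∈ B ↔ v ∈ Y ∧ (graph σ).Adj u v)
    (hAB : 0 < A.card + B.card) :
    cost b c σ u =
      (bicliqueCost b c n X.card Y.card (σ u).1.card A.card B.card : EReal) := by
  have hAB' : A.Nonempty ∨ B.Nonempty := by
    simpa only [Finset.card_pos] using add_pos_iff.1 hAB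
  have hAX : A.card ≤ X.card := Finset.card_le_card fun v hv => ((hA v).1 hv).1
  have hBY : B.card ≤ Y.card := Finset.card_le_card fun v hv => ((hB v).1 hv).1
  rw [cost, betweenness, closeness, h.sum_numShortestThrough_div hA hB,
    h.sum_edist_sub_one hA hB hAB', bicliqueCost, ENat.toENNReal_coe, coe_ennreal_natCast,
    ← EReal.coe_mul, ← EReal.coe_add, ← EReal.coe_add]
  -- The truncated subtractions are genuine because `A` and `B` lie inside the parts.
  push_cast [Nat.cast_sub hAX, Nat.cast_sub hBY]
  rfl

lemma cost_eq_top (hc : 0 < c) (h : IsBicliqueAround (graph σ) u X Y)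
    (hN : ∀ v, ¬ (graph σ).Adj u v) : cost b c σ u = ⊤ := by
  rw [cost, closeness, h.sum_edist_sub_one_eq_top hN, ENat.toENNReal_top,
    EReal.coe_ennreal_top, EReal.coe_mul_top_of_pos hc, ← EReal.coe_add, EReal.coe_add_top]

end Cost

/-! ### Deviations from the one-sided biclique -/

section Deviation

variable {n : ℕ} {σ : Profile n} {u x y : Fin n} {t : {t : Finset (Fin n) // u ∉ t}}

lemma graph_update_adj (hx : x ≠ u) (hy : y ≠ u) :
    (graph (Function.update σ u t)).Adj x y ↔ (graph σ).Adj x y := by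
  simp [graph, SimpleGraph.fromRel_adj, Function.update_of_ne hx, Function.update_of_ne hy]

lemma graph_update_adj_self (hx : x ≠ u) :
    (graph (Function.update σ u t)).Adj u x ↔ x ∈ t.1 ∨ u ∈ (σ x).1 := by
  simp [graph, SimpleGraph.fromRel_adj, Function.update_of_ne hx, hx.symm]

end Deviation

/-- `G[σ]` is the complete bipartite graph with parts `L` and `Lᶜ`, and all the channels are opened
by the players of `L`. -/
structure IsOneSidedBiclique {n : ℕ} (σ : Profile n) (L : Finset (Fin n)) : Prop where
  adj_iff : ∀ x y, (graph σ).Adj x y ↔ (x ∈ L ↔ y ∉ L)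
  eq_empty : ∀ v, v ∉ L → (σ v).1 = ∅

namespace IsOneSidedBiclique

variable {n : ℕ} {b c : ℝ} {σ : Profile n} {L : Finset (Fin n)} {u v : Fin n}

lemma apply_eq_compl (h : IsOneSidedBiclique σ L) (hu : u ∈ L) : (σ u).1 = Lᶜ := by
  ext v
  rw [Finset.mem_compl]
  constructor
  · intro hv
    have huv : u ≠ v := fun e => (σ u).2 (e ▸ hv)
    exact ((h.adj_iff u v).1 (by rw [graph, SimpleGraph.fromRel_adj]; exact ⟨huv, .inl hv⟩)).1 hu
  · intro hv
    have hadj := (h.adj_iff u v).2 (by simp [hu, hv])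
    rw [graph, SimpleGraph.fromRel_adj, h.eq_empty v hv] at hadj
    simpa using hadj.2

lemma isBicliqueAround_of_mem (h : IsOneSidedBiclique σ L) (hu : u ∈ L) (hL : 2 ≤ L.card)
    (hR : 1 ≤ Lᶜ.card) (t : {t : Finset (Fin n) // u ∉ t}) :
    IsBicliqueAround (graph (Function.update σ u t)) u Lᶜ (L.erase u) where
  notMem_left := by simpa using hu
  notMem_right := by simp
  disjoint := disjoint_compl_left.mono_right (Finset.erase_subset _ _)
  cover v hv := by by_cases hvL : v ∈ L <;> simp [hvL, hv]
  nonempty_left := Finset.card_pos.1 hR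
  nonempty_right := by rw [← Finset.card_pos, Finset.card_erase_of_mem hu]; omega
  adj x hx y hy := by
    simp only [Finset.mem_compl, Finset.mem_erase] at hx hy
    rw [graph_update_adj (ne_of_mem_of_not_mem hu hx).symm hy.1, h.adj_iff]
    simp [hx, hy.2]
  indep_left x hx y hy := by
    rw [Finset.mem_compl] at hx hy
    rw [graph_update_adj (ne_of_mem_of_not_mem hu hx).symm (ne_of_mem_of_not_mem hu hy).symm, h.adj_iff]
    simp [hx, hy]
  indep_right x hx y hy := by
    rw [Finset.mem_erase] at hx hy
    rw [graph_update_adj hx.1 hy.1, h.adj_iff]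
    simp [hx, hy]

lemma isBicliqueAround_of_notMem (h : IsOneSidedBiclique σ L) (hu : u ∉ L) (hL : 1 ≤ L.card)
    (hR : 2 ≤ Lᶜ.card) (t : {t : Finset (Fin n) // u ∉ t}) :
    IsBicliqueAround (graph (Function.update σ u t)) u L (Lᶜ.erase u) where
  notMem_left := hu
  notMem_right := by simp
  disjoint := disjoint_compl_right.mono_right (Finset.erase_subset _ _)
  cover v hv := by by_cases hvL : v ∈ L <;> simp [hvL, hv]
  nonempty_left := Finset.card_pos.1 hL
  nonempty_right := by
    rw [← Finset.card_pos, Finset.card_erase_of_mem (Finset.mem_compl.2 hu)]; omega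
  adj x hx y hy := by
    simp only [Finset.mem_compl, Finset.mem_erase] at hx hy
    rw [graph_update_adj (ne_of_mem_of_not_mem hx hu) hy.1, h.adj_iff]
    simp [hx, hy.2]
  indep_left x hx y hy := by
    rw [graph_update_adj (ne_of_mem_of_not_mem hx hu) (ne_of_mem_of_not_mem hy hu), h.adj_iff]
    simp [hx, hy]
  indep_right x hx y hy := by
    simp only [Finset.mem_compl, Finset.mem_erase] at hx hy
    rw [graph_update_adj hx.1 hy.1, h.adj_iff]
    simp [hx, hy]

/-- Nobody opens a channel to a player of `L`, so she controls all her links. -/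
lemma graph_update_adj_iff_of_mem (h : IsOneSidedBiclique σ L) (hu : u ∈ L)
    (t : {t : Finset (Fin n) // u ∉ t}) :
    (graph (Function.update σ u t)).Adj u v ↔ v ∈ t.1 := by
  rcases eq_or_ne v u with rfl | hv
  · simpa using t.2
  · rw [graph_update_adj_self hv, or_iff_left]
    by_cases hvL : v ∈ L
    · simpa [h.apply_eq_compl hvL] using hu
    · simp [h.eq_empty v hvL]

/-- The links from `L` are maintained by `L` and survive any deviation of `u`. -/
lemma graph_update_adj_iff_of_notMem (h : IsOneSidedBiclique σ L) (hu : u ∉ L)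
    (t : {t : Finset (Fin n) // u ∉ t}) :
    (graph (Function.update σ u t)).Adj u v ↔ v ∈ t.1 ∨ v ∈ L := by
  rcases eq_or_ne v u with rfl | hv
  · simpa [hu] using t.2
  · rw [graph_update_adj_self hv]
    by_cases hvL : v ∈ L
    · simp [h.apply_eq_compl hvL, hu, hvL]
    · simp [h.eq_empty v hvL, hvL]

lemma cost_update_of_mem (h : IsOneSidedBiclique σ L) (hu : u ∈ L) (hL : 2 ≤ L.card)
    (hR : 1 ≤ Lᶜ.card) (t : {t : Finset (Fin n) // u ∉ t}) (ht : t.1.Nonempty) :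
    cost b c (Function.update σ u t) u =
      (bicliqueCost b c n Lᶜ.card (L.card - 1) ((t.1 \ L).card + (t.1 ∩ L).card)
        (t.1 \ L).card (t.1 ∩ L).card : EReal) := by
  have hcard : (t.1 \ L).card + (t.1 ∩ L).card = t.1.card := Finset.card_sdiff_add_card_inter _ _
  rw [cost_eq_bicliqueCost (h.isBicliqueAround_of_mem hu hL hR t) (A := t.1 \ L) (B := t.1 ∩ L),
    Function.update_self, hcard, Finset.card_erase_of_mem hu]
  · intro v
    rw [h.graph_update_adj_iff_of_mem hu, Finset.mem_sdiff, Finset.mem_compl, and_comm]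
  · intro v
    rw [h.graph_update_adj_iff_of_mem hu, Finset.mem_inter, Finset.mem_erase]
    constructor
    · rintro ⟨h1, h2⟩
      exact ⟨⟨fun e => t.2 (e ▸ h1), h2⟩, h1⟩
    · rintro ⟨⟨-, h2⟩, h1⟩
      exact ⟨h1, h2⟩
  · rw [hcard]
    exact Finset.card_pos.2 ht

lemma cost_update_of_notMem (h : IsOneSidedBiclique σ L) (hu : u ∉ L) (hL : 1 ≤ L.card)
    (hR : 2 ≤ Lᶜ.card) (t : {t : Finset (Fin n) // u ∉ t}) :
    cost b c (Function.update σ u t) u =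
      (bicliqueCost b c n L.card (Lᶜ.card - 1) t.1.card L.card (t.1 \ L).card : EReal) := by
  rw [cost_eq_bicliqueCost (h.isBicliqueAround_of_notMem hu hL hR t) (A := L) (B := t.1 \ L),
    Function.update_self, Finset.card_erase_of_mem (Finset.mem_compl.2 hu)]
  · intro v
    rw [h.graph_update_adj_iff_of_notMem hu]
    tauto
  · intro v
    rw [h.graph_update_adj_iff_of_notMem hu, Finset.mem_sdiff, Finset.mem_erase, Finset.mem_compl]
    constructor
    · rintro ⟨h1, h2⟩
      exact ⟨⟨fun e => t.2 (e ▸ h1), h2⟩, .inl h1⟩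
    · rintro ⟨⟨-, h2⟩, h1⟩
      exact ⟨h1.resolve_right h2, h2⟩
  · omega

lemma forall_cost_le_iff_of_mem (h : IsOneSidedBiclique σ L) (hc : 0 < c) (hu : u ∈ L)
    (hL : 2 ≤ L.card) (hR : 1 ≤ Lᶜ.card) :
    (∀ t, cost b c σ u ≤ cost b c (Function.update σ u t) u) ↔
      ∀ a l : ℕ, a ≤ Lᶜ.card → l ≤ L.card - 1 → 0 < a + l →
        bicliqueCost b c n Lᶜ.card (L.card - 1) Lᶜ.card Lᶜ.card 0 ≤
          bicliqueCost b c n Lᶜ.card (L.card - 1) (a + l) a l := by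
  have hcur : cost b c σ u =
      (bicliqueCost b c n Lᶜ.card (L.card - 1) Lᶜ.card Lᶜ.card 0 : EReal) := by
    have hσ := h.apply_eq_compl hu
    have := h.cost_update_of_mem (b := b) (c := c) hu hL hR (σ u)
      (by rw [hσ]; exact Finset.card_pos.1 hR)
    have h1 : Lᶜ \ L = Lᶜ := sdiff_eq_left.2 disjoint_compl_left
    have h2 : Lᶜ ∩ L = ∅ := Finset.disjoint_iff_inter_eq_empty.1 disjoint_compl_left
    rwa [Function.update_eq_self, hσ, h1, h2, Finset.card_empty, add_zero] at this
  rw [hcur]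
  constructor
  · intro H a l ha hl hal
    obtain ⟨A, hA, rfl⟩ := Finset.exists_subset_card_eq ha
    rw [← Finset.card_erase_of_mem hu] at hl
    obtain ⟨B, hB, rfl⟩ := Finset.exists_subset_card_eq hl
    have hBL := hB.trans (Finset.erase_subset _ _)
    have huA : u ∉ A := fun hA' => Finset.mem_compl.1 (hA hA') hu
    have huB : u ∉ B := fun hB' => Finset.notMem_erase u L (hB hB')
    have hd : Disjoint A L := disjoint_compl_left.mono_left hA
    have e1 : (A ∪ B) \ L = A := by
      rw [Finset.union_sdiff_distrib, Finset.sdiff_eq_empty_iff_subset.2 hBL, Finset.union_empty,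
        sdiff_eq_left.2 hd]
    have e2 : (A ∪ B) ∩ L = B := by
      rw [Finset.union_inter_distrib_right, Finset.disjoint_iff_inter_eq_empty.1 hd,
        Finset.empty_union, Finset.inter_eq_left.2 hBL]
    have := H ⟨A ∪ B, by simp [huA, huB]⟩
    rw [h.cost_update_of_mem hu hL hR _ (Finset.card_pos.1 ?_)] at this
    · simpa only [e1, e2, EReal.coe_le_coe_iff] using this
    · rw [← Finset.card_sdiff_add_card_inter (A ∪ B) L, e1, e2]
      exact hal
  · intro H t
    rcases t.1.eq_empty_or_nonempty with ht | ht
    -- With no channel the player is isolated, and `c > 0` makes her cost infinite.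
    · rw [cost_eq_top hc (h.isBicliqueAround_of_mem hu hL hR t)]
      · exact le_top
      · intro v
        rw [h.graph_update_adj_iff_of_mem hu, ht]
        exact Finset.notMem_empty v
    · rw [h.cost_update_of_mem hu hL hR t ht, EReal.coe_le_coe_iff]
      refine H _ _ (Finset.card_le_card fun v hv => ?_) ?_ ?_
      · exact Finset.mem_compl.2 (Finset.mem_sdiff.1 hv).2
      · rw [← Finset.card_erase_of_mem hu]
        refine Finset.card_le_card fun v hv => ?_
        rw [Finset.mem_inter] at hv
        exact Finset.mem_erase.2 ⟨fun e => t.2 (e ▸ hv.1), hv.2⟩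
      · rw [Finset.card_sdiff_add_card_inter]
        exact Finset.card_pos.2 ht

lemma forall_cost_le_iff_of_notMem (h : IsOneSidedBiclique σ L) (hu : u ∉ L)
    (hL : 1 ≤ L.card) (hR : 2 ≤ Lᶜ.card) :
    (∀ t, cost b c σ u ≤ cost b c (Function.update σ u t) u) ↔
      ∀ l : ℕ, l ≤ Lᶜ.card - 1 →
        bicliqueCost b c n L.card (Lᶜ.card - 1) 0 L.card 0 ≤
          bicliqueCost b c n L.card (Lᶜ.card - 1) l L.card l := by
  have hcur : cost b c σ u = (bicliqueCost b c n L.card (Lᶜ.card - 1) 0 L.card 0 : EReal) := by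
    have := h.cost_update_of_notMem (b := b) (c := c) hu hL hR (σ u)
    rwa [Function.update_eq_self, h.eq_empty u hu, Finset.empty_sdiff, Finset.card_empty] at this
  have hue : (Lᶜ.erase u).card = Lᶜ.card - 1 := Finset.card_erase_of_mem (Finset.mem_compl.2 hu)
  rw [hcur]
  constructor
  · intro H l hl
    rw [← hue] at hl
    obtain ⟨B, hB, rfl⟩ := Finset.exists_subset_card_eq hl
    have hBL : B \ L = B :=
      sdiff_eq_left.2 (disjoint_compl_left.mono_left (hB.trans (Finset.erase_subset _ _)))
    have := H ⟨B, fun hB' => Finset.notMem_erase u _ (hB hB')⟩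
    rw [h.cost_update_of_notMem hu hL hR] at this
    simpa only [hBL, EReal.coe_le_coe_iff] using this
  · intro H t
    rw [h.cost_update_of_notMem hu hL hR, EReal.coe_le_coe_iff]
    -- Channels into `L` duplicate existing links; dropping them only saves their price.
    refine (H (t.1 \ L).card ?_).trans ?_
    · rw [← hue]
      refine Finset.card_le_card fun v hv => ?_
      rw [Finset.mem_sdiff] at hv
      exact Finset.mem_erase.2 ⟨fun e => t.2 (e ▸ hv.1), Finset.mem_compl.2 hv.2⟩
    · have : ((t.1 \ L).card : ℝ) ≤ t.1.card :=
        Nat.cast_le.2 (Finset.card_le_card Finset.sdiff_subset)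
      simp only [bicliqueCost]
      gcongr

end IsOneSidedBiclique

/-! ### Inequalities between real costs -/

lemma nonneg_of_concave_quadratic {p q k x₀ x₁ x : ℝ} (hk : 0 ≤ k) (h₀ : x₀ ≤ x) (h₁ : x ≤ x₁)
    (hx₀ : 0 ≤ p + q * x₀ - k * (x₀ * (x₀ - 1))) (hx₁ : 0 ≤ p + q * x₁ - k * (x₁ * (x₁ - 1))) :
    0 ≤ p + q * x - k * (x * (x - 1)) := by
  rcases h₀.eq_or_lt with rfl | hlt
  · exact hx₀
  · have hpos : 0 < x₁ - x₀ := by linarith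
    refine nonneg_of_mul_nonneg_right ?_ hpos
    -- The chord through the endpoint values, plus the nonnegative excess of a concave quadratic
    -- over its chord.
    have e : (x₁ - x₀) * (p + q * x - k * (x * (x - 1))) =
        (x₁ - x) * (p + q * x₀ - k * (x₀ * (x₀ - 1))) +
        (x - x₀) * (p + q * x₁ - k * (x₁ * (x₁ - 1))) +
        k * ((x₁ - x₀) * ((x - x₀) * (x₁ - x))) := by ring
    rw [e]
    have a1 : 0 ≤ x₁ - x := by linarith
    have a2 : 0 ≤ x - x₀ := by linarith
    positivity

variable {b c : ℝ} {n r s : ℕ}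

/-- Adding `l` links changes the cost by `l` times a factor nonincreasing in `l`, so `l = s - 1` is
the decisive case. -/
lemma forall_bicliqueCost_le_right_iff (hb : 0 ≤ b) (hr : 1 ≤ r) (hs : 2 ≤ s) :
    (∀ l : ℕ, l ≤ s - 1 →
      bicliqueCost b c n r (s - 1) 0 r 0 ≤ bicliqueCost b c n r (s - 1) l r l) ↔
      ((s : ℝ) - 2) / ((r : ℝ) + 1) * b + c ≤ 1 := by
  have hr0 : r ≠ 0 := by omega
  have hs' : (2 : ℝ) ≤ s := by exact_mod_cast hs
  have hr1 : (0 : ℝ) < r + 1 := by positivity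
  have diff : ∀ l : ℕ, bicliqueCost b c n r (s - 1) l r l - bicliqueCost b c n r (s - 1) 0 r 0 =
      l * (1 - (((l : ℝ) - 1) / (r + 1) * b + c)) := by
    intro l
    simp only [bicliqueCost, hr0, if_false, Nat.cast_zero]
    ring
  have diff' : ∀ l : ℕ,
      bicliqueCost b c n r (s - 1) 0 r 0 ≤ bicliqueCost b c n r (s - 1) l r l ↔
      0 ≤ l * (1 - (((l : ℝ) - 1) / (r + 1) * b + c)) := by
    intro l
    rw [← diff, sub_nonneg]
  simp only [diff']
  constructor
  · intro H
    have := H (s - 1) le_rfl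
    rw [Nat.cast_sub (by omega), Nat.cast_one] at this
    have := nonneg_of_mul_nonneg_right this (by linarith)
    rw [show (s : ℝ) - 2 = s - 1 - 1 by ring]
    linarith
  · intro H l hl
    refine mul_nonneg (Nat.cast_nonneg l) ?_
    have hl' : (l : ℝ) ≤ s - 1 := by
      rw [← Nat.cast_one, ← Nat.cast_sub (by omega)]
      exact_mod_cast hl
    have : ((l : ℝ) - 1) / (r + 1) * b ≤ ((s : ℝ) - 2) / (r + 1) * b :=
      mul_le_mul_of_nonneg_right (div_le_div_of_nonneg_right (by linarith) hr1.le) hb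
    linarith

lemma bicliqueCost_sub_left (hr : 1 ≤ r) (hs : 1 ≤ s) (a l : ℕ) :
    bicliqueCost b c n s (r - 1) (a + l) a l - bicliqueCost b c n s (r - 1) s s 0 =
      (a : ℝ) + l - s + b / r * (s * (s - 1) - a * (a - 1)) - b / (s + 1) * (l * (l - 1)) +
        c * (((s : ℝ) - a) * (if l = 0 then 2 else 1) +
          ((r : ℝ) - 1 - l) * (if a = 0 then 2 else 1) - (r - 1)) := by
  have hs0 : s ≠ 0 := by omega
  simp only [bicliqueCost, hs0, if_false, if_true, Nat.cast_sub hr, Nat.cast_zero, Nat.cast_one,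
    Nat.cast_add, sub_add_cancel]
  ring

lemma forall_bicliqueCost_le_left_iff (hb : 0 ≤ b) (hr : 3 ≤ r) (hrs : r ≤ s)
    (hright : ((s : ℝ) - 2) / ((r : ℝ) + 1) * b + c ≤ 1) (hc : 0 < c) :
    (∀ a l : ℕ, a ≤ s → l ≤ r - 1 → 0 < a + l →
      bicliqueCost b c n s (r - 1) s s 0 ≤ bicliqueCost b c n s (r - 1) (a + l) a l) ↔
      1 ≤ (s : ℝ) / r * b + ((s : ℝ) + r - 3) / (s - 1) * c ∧
        1 ≤ bicliqueAlpha r s * b + c ∧ 1 ≤ bicliqueBeta r s * b + c := by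
  have hr' : (3 : ℝ) ≤ r := by exact_mod_cast hr
  have hrs' : (r : ℝ) ≤ s := by exact_mod_cast hrs
  have diff : ∀ a l : ℕ, bicliqueCost b c n s (r - 1) s s 0 ≤
      bicliqueCost b c n s (r - 1) (a + l) a l ↔ 0 ≤
      (a : ℝ) + l - s + b / r * (s * (s - 1) - a * (a - 1)) - b / (s + 1) * (l * (l - 1)) +
        c * (((s : ℝ) - a) * (if l = 0 then 2 else 1) +
          ((r : ℝ) - 1 - l) * (if a = 0 then 2 else 1) - (r - 1)) := by
    intro a l
    rw [← bicliqueCost_sub_left (by omega) (by omega), sub_nonneg]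
  have hr1 : ((r - 1 : ℕ) : ℝ) = r - 1 := by rw [Nat.cast_sub (by omega), Nat.cast_one]
  have hK : 0 ≤ b / r := by positivity
  have hM : 0 ≤ b / (s + 1) := by positivity
  have first : 1 ≤ (s : ℝ) / r * b + ((s : ℝ) + r - 3) / (s - 1) * c ↔
      0 ≤ 1 - (s : ℝ) + b / r * (s * (s - 1)) + c * (s + r - 3) := by
    have e : 1 - (s : ℝ) + b / r * (s * (s - 1)) + c * (s + r - 3) =
        (s - 1) * ((s : ℝ) / r * b + ((s : ℝ) + r - 3) / (s - 1) * c - 1) := by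
      have : (s : ℝ) - 1 ≠ 0 := by linarith
      field_simp
      ring
    rw [e, mul_nonneg_iff_of_pos_left (by linarith), sub_nonneg]
  have alpha : 1 ≤ bicliqueAlpha r s * b + c ↔
      0 ≤ 2 - (s : ℝ) + b / r * (s * (s - 1)) + c * (s - 2) := by
    have e : 2 - (s : ℝ) + b / r * (s * (s - 1)) + c * (s - 2) =
        (s - 2) * (bicliqueAlpha r s * b + c - 1) := by
      have : (s : ℝ) - 2 ≠ 0 := by linarith
      rw [bicliqueAlpha]
      field_simp
      ring
    rw [e, mul_nonneg_iff_of_pos_left (by linarith), sub_nonneg]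
  have beta : 1 ≤ bicliqueBeta r s * b + c ↔
      0 ≤ (r : ℝ) - 1 - s + b / r * (s * (s - 1)) - b / (s + 1) * ((r - 1) * (r - 2)) +
        c * (s - r + 1) := by
    have e : (r : ℝ) - 1 - s + b / r * (s * (s - 1)) - b / (s + 1) * ((r - 1) * (r - 2)) +
        c * (s - r + 1) = (s - r + 1) * (bicliqueBeta r s * b + c - 1) := by
      have : (s : ℝ) - r + 1 ≠ 0 := by linarith
      rw [bicliqueBeta]
      field_simp
      ring
    rw [e, mul_nonneg_iff_of_pos_left (by linarith), sub_nonneg]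
  simp only [diff]
  rw [first, alpha, beta]
  constructor
  · intro H
    refine ⟨?_, ?_, ?_⟩
    · have := H 0 1 (by omega) (by omega) (by omega)
      norm_num at this
      linarith
    · have := H 1 1 (by omega) (by omega) (by omega)
      norm_num at this
      linarith
    · have := H 0 (r - 1) (by omega) le_rfl (by omega)
      rw [if_neg (by omega), hr1] at this
      norm_num at this
      linarith
  · rintro ⟨hfirst, halpha, hbeta⟩ a l ha hl hal
    have ha' : (a : ℝ) ≤ s := by exact_mod_cast ha
    have hl' : (l : ℝ) ≤ r - 1 := by rw [← hr1]; exact_mod_cast hl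
    have hc1 : c ≤ 1 := by
      have : 0 ≤ ((s : ℝ) - 2) / ((r : ℝ) + 1) * b :=
        mul_nonneg (div_nonneg (by linarith) (by linarith)) hb
      linarith
    -- Since `r ≤ s`, `(r - 2) / (s + 1) ≤ (s - 2) / (r + 1)`. This settles the corner `a = s`, `l =
    -- r - 1`.
    have hcorner : b / (s + 1) * ((r : ℝ) - 2) + c ≤ 1 := by
      refine le_trans (add_le_add_left ?_ c) hright
      rw [div_mul_eq_mul_div, div_mul_eq_mul_div, mul_comm b]
      exact div_le_div₀ (mul_nonneg (by linarith) hb)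
        (mul_le_mul_of_nonneg_right (by linarith) hb) (by linarith) (by linarith)
    rcases Nat.eq_zero_or_pos a with rfl | ha0 <;> rcases Nat.eq_zero_or_pos l with rfl | hl0
    · omega
    · have hl1 : (1 : ℝ) ≤ l := by exact_mod_cast hl0
      rw [if_neg hl0.ne', if_pos rfl]
      have := nonneg_of_concave_quadratic
        (p := -(s : ℝ) + b / r * (s * (s - 1)) + c * (s + r - 1)) (q := 1 - 2 * c)
        hM hl1 hl' (by linarith) (by linarith)
      push_cast
      linarith
    · have ha1 : (1 : ℝ) ≤ a := by exact_mod_cast ha0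
      rw [if_pos rfl, if_neg ha0.ne']
      -- At `a = s` the change is 0. At `a = 1` it exceeds the expression in `hfirst` by `c * (s - r
      -- + 1) ≥ 0`.
      have := nonneg_of_concave_quadratic
        (p := -(s : ℝ) + b / r * (s * (s - 1)) + 2 * c * s) (q := 1 - 2 * c)
        hK ha1 ha' (by nlinarith) (by linarith)
      push_cast
      linarith
    · have ha1 : (1 : ℝ) ≤ a := by exact_mod_cast ha0
      have hl1 : (1 : ℝ) ≤ l := by exact_mod_cast hl0
      rw [if_neg hl0.ne', if_neg ha0.ne']
      -- The edge `a = 1`: its end `l = 1` is `halpha`, and its end `l = r - 1` is `hbeta` plus `1 -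
      -- c ≥ 0`.
      have hone := nonneg_of_concave_quadratic
        (p := 1 - (s : ℝ) + b / r * (s * (s - 1)) + c * (s - 1)) (q := 1 - c)
        hM hl1 hl' (by linarith) (by linarith)
      -- The edge `a = s`; interpolating in `a` between the two edges then covers every `a ≥ 1` for
      -- this `l`.
      have hall := nonneg_of_concave_quadratic (p := 0) (q := 1 - c) hM hl1 hl' (by linarith) (by
        have : 0 ≤ ((r : ℝ) - 1) * (1 - (b / (s + 1) * ((r : ℝ) - 2) + c)) :=
          mul_nonneg (by linarith) (by linarith)
        linarith)
      have := nonneg_of_concave_quadratic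
        (p := l - (s : ℝ) + b / r * (s * (s - 1)) - b / (s + 1) * (l * (l - 1)) + c * (s - l))
        (q := 1 - c) hK ha1 ha' (by linarith) (by linarith)
      linarith

end PaymentNetwork

/-! ### The characterization of equilibria -/

/-- `σ` is a strategy combination on `[n]` whose network is `K_{r,s}` (through the isomorphism `φ`)
and in which the players of the subset of size `s` open no channel, so that all the links are
established by the smaller subset. -/
theorem mainTheorem7 (n r s : ℕ) (hr : 3 ≤ r) (hrs : r ≤ s)
    (b c : ℝ) (hb : 0 ≤ b) (hc : 0 < c)
    (σ : PaymentNetwork.Profile n)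
    (φ : PaymentNetwork.graph σ ≃g completeBipartiteGraph (Fin r) (Fin s))
    (hσ : ∀ j : Fin s, (σ (φ.symm (Sum.inr j))).1 = ∅) :
    PaymentNetwork.IsNashEquilibrium b c σ ↔
      ((s : ℝ) - 2) / ((r : ℝ) + 1) * b + c ≤ 1 ∧
        1 ≤ min ((s : ℝ) / (r : ℝ) * b + ((s : ℝ) + (r : ℝ) - 3) / ((s : ℝ) - 1) * c)
          (min (PaymentNetwork.bicliqueAlpha r s) (PaymentNetwork.bicliqueBeta r s) * b + c) := by
  classical
  let L : Finset (Fin n) := Finset.univ.filter fun v => (φ v).isLeft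
  have hLmem : ∀ v, v ∈ L ↔ (φ v).isLeft := fun v => by simp [L]
  have hL : L.card = r := by
    have : L = Finset.univ.map ⟨fun i : Fin r => φ.symm (Sum.inl i),
        φ.symm.injective.comp Sum.inl_injective⟩ := by
      ext v
      rw [hLmem, Sum.isLeft_iff, Finset.mem_map]
      simp only [Finset.mem_univ, true_and, Function.Embedding.coeFn_mk]
      exact exists_congr fun i => ⟨fun e => by rw [← e, φ.symm_apply_apply],
        fun e => by rw [← e, φ.apply_symm_apply]⟩
    rw [this, Finset.card_map, Finset.card_univ, Fintype.card_fin]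
  have hn : n = r + s := by
    simpa using Fintype.card_congr φ.toEquiv
  have hLc : Lᶜ.card = s := by
    rw [Finset.card_compl, hL, Fintype.card_fin]
    omega
  have h : PaymentNetwork.IsOneSidedBiclique σ L := by
    refine ⟨fun x y => ?_, fun v hv => ?_⟩
    · rw [← φ.map_adj_iff, hLmem, hLmem]
      rcases φ x with i | i <;> rcases φ y with j | j <;> simp
    · rw [hLmem] at hv
      obtain ⟨j, hj⟩ := Sum.isRight_iff.1 (by simpa using hv)
      rw [← hσ j, ← hj, φ.symm_apply_apply]
  obtain ⟨u, hu⟩ : L.Nonempty := Finset.card_pos.1 (by omega)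
  obtain ⟨v, hv⟩ : Lᶜ.Nonempty := Finset.card_pos.1 (by omega)
  rw [Finset.mem_compl] at hv
  have left : ∀ w ∈ L, _ := fun w hw =>
    h.forall_cost_le_iff_of_mem (b := b) hc hw (by omega) (by omega)
  have right : ∀ w ∉ L, _ := fun w hw =>
    h.forall_cost_le_iff_of_notMem (b := b) (c := c) hw (by omega) (by omega)
  rw [hL, hLc] at left right
  -- The conditions depend only on the side of a player, so one representative of each side
  -- suffices.
  have split : PaymentNetwork.IsNashEquilibrium b c σ ↔
      (∀ t, PaymentNetwork.cost b c σ v ≤ PaymentNetwork.cost b c (Function.update σ v t) v) ∧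
      (∀ t, PaymentNetwork.cost b c σ u ≤ PaymentNetwork.cost b c (Function.update σ u t) u) := by
    refine ⟨fun H => ⟨H v, H u⟩, fun ⟨Hv, Hu⟩ w => ?_⟩
    by_cases hw : w ∈ L
    · exact (left w hw).2 ((left u hu).1 Hu)
    · exact (right w hw).2 ((right v hv).1 Hv)
  rw [split, left u hu, right v hv,
    PaymentNetwork.forall_bicliqueCost_le_right_iff hb (by omega) (by omega), le_min_iff,
    min_mul_of_nonneg _ _ hb, ← min_add_add_right, le_min_iff]
  exact and_congr_right fun hright =>
    PaymentNetwork.forall_bicliqueCost_le_left_iff hb hr hrs hright hc
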